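/- **Setting.** Let $p>3$ be a prime, $k$ a perfect field of characteristic $p$ with algebraic closure $\bar k$, $W=W(k)$, $\overline W=W(\bar k)$ the rings of Witt vectors with Frobenius $\sigma$, $K^{\mathrm u}=\overline W[1/p]$, $A=W[[t_1,\dots,t_n]]$, $A_0=A/pA=k[[t_1,\dots,t_n]]$, $\overline A=\overline W[[t_1,\dots,t_n]]$. A lift of Frobenius is a ring endomorphism $\phi$ of $A$ with $\phi|_W=\sigma$ and $\phi(a)\equiv a^p \bmod p$; the standard one has $\phi(t_i)=t_i^p$. Let $\Omega^1_{A/W}$ be the free $A$-module on $dt_1,\dots,dt_n$. An *$F$-crystal* over $A_0$ is a finitely generated free $A$-module $H$ with an integrable, $p$-adically topologically nilpotent connection $\nabla=\sum_j dt_j\otimes D_j$ and, for each lift of Frobenius $\phi$, a horizontal $\phi$-linear map $F(\phi)\phi^*:H\to H$ whose linearization $F(\phi):\phi^*H\to H$ is an isomorphism after inverting $p$, such that for all lifts $\phi,\psi$ $$F(\phi)\phi^*(x)=\sum_{m\in\mathbb N^n}\prod_j\frac{(\phi(t_j)-\psi(t_j))^{m_j}}{m_j!}\,F(\psi)\psi^*(D_1^{m_1}\cdots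 D_n^{m_n}x).$$ It is *unit* if $F(\phi)$ is an isomorphism. On $H_0=H/pH$ let $\mathrm{Fil}_iH_0$ be the set of classes of $y\in H$ with $p^iy\in\mathrm{Im}\,F(\phi)$, and $\mathrm{Fil}^iH_0$ the set of classes of $y$ with $F(\phi)\phi^*y\in p^iH$ (these do not depend on $\phi$). $H$ is of *level $\le 3$* if $\mathrm{Fil}_3H_0=H_0$ and $\mathrm{Fil}^4H_0=0$, and *ordinary* if all $\mathrm{Fil}_iH_0/\mathrm{Fil}_{i-1}H_0$ are free over $A_0$ and $H_0=\mathrm{Fil}_iH_0\oplus\mathrm{Fil}^{i+1}H_0$ for all $i$. In the ordinary case let $0=U_{-1}\subset U_0\subset U_1\subset\cdots$ be the unique filtration of $H$ by sub-$F$-crystals with $U_i\otimes_AA_0=\mathrm{Fil}_iH_0$ and $U_i/U_{i-1}\simeq V_i(-i)$, where $V_i$ is a unit $F$-crystal and $(-i)$ multiplies $F(\phi)$ by $p^i$. A *Hodge $F$-crystal* is an $F$-crystal with a decreasing filtration $H=\mathrm{Fil}^0H\supset\mathrm{Fil}^1H\supset\cdots$ by free submodules with $\mathrm{Fil}^iH\otimes_AA_0=\mathrm{Fil}^iH_0$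 and $\nabla\,\mathrm{Fil}^iH\subset\Omega^1_{A/W}\otimes\mathrm{Fil}^{i-1}H$. If it is of level $\le 3$, it is *divisible* if $F(\phi)\phi^*\mathrm{Fil}^iH\subset p^iH$ for $0\le i\le3$ and some $\phi$. Put $H^i=U_i\cap\mathrm{Fil}^iH$. Let $H$ be a divisible ordinary Hodge $F$-crystal over $A_0$ of level $\le 3$, with $\mathrm{rank}\,H^0=\mathrm{rank}\,H^3=1$ and $\mathrm{rank}\,H^1=\mathrm{rank}\,H^2=h$, equipped with a perfect alternating $A$-bilinear form $\langle\,,\rangle:H\times H\to A$ such that $\langle\nabla x,y\rangle+\langle x,\nabla y\rangle=d\langle x,y\rangle$, $\langle F(\phi)\phi^*x,F(\phi)\phi^*y\rangle=p^3\phi(\langle x,y\rangle)$ for every $\phi$, $(\mathrm{Fil}^3H)^\perp=\mathrm{Fil}^1H$ and $(\mathrm{Fil}^2H)^\perp=\mathrm{Fil}^2H$. Assume that the map $\mathrm{Hom}_A(\Omega^1_{A/W},A)\to\mathrm{Hom}_A(H^3,H^2)$ induced by $\nabla$ (through $H^3=\mathrm{Fil}^3H$ and $H^2\simeq\mathrm{Fil}^2H/\mathrm{Fil}^3H$)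 is an isomorphism. Let $\overline H=\overline A\otimes_AH$ carry the structures obtained by base change, and $\overline H^i=\overline U_i\cap\mathrm{Fil}^i\overline H$. Let $e_0,\dots,e_{2h+1}$ be an $\overline A$-basis of $\overline H$ with $e_0\in\overline H^0$, $e_1,\dots,e_h\in\overline H^1$, $e_{h+1},\dots,e_{2h}\in\overline H^2$, $e_{2h+1}\in\overline H^3$, with Gram matrix $$\begin{pmatrix}0&0&0&-1\\0&0&I_h&0\\0&-I_h&0&0\\1&0&0&0\end{pmatrix},$$ and such that for some matrix $$\mathcal T=\begin{pmatrix}1&\tau_{23}^{\mathsf T}&0&0\\0&I_h&0&0\\0&0&I_h&\tau_{23}\\0&0&0&1\end{pmatrix}\begin{pmatrix}1&0&-\tau_{13}^{\mathsf T}&Z\\0&I_h&\tau_{12}&\tau_{13}\\0&0&I_h&0\\0&0&0&1\end{pmatrix}$$ with entries in $K^{\mathrm u}[[t_1,\dots,t_n]]$ the matrix of $\nabla$ in this basis is $\mathcal T^{-1}d\mathcal T$ and, for the standard lift of Frobenius $\phi$ of $\overline A$, the matrix of $F(\phi)\phi^*$ is $\mathcal T^{-1}P\,\phi(\mathcal T)$,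 where $P=\mathrm{diag}(1,pI_h,p^2I_h,p^3)$. **Lemma.** Let $\omega_0$ be a generator of the $A$-module $\mathrm{Fil}^3H$. Then there is an invertible element $f\in\overline A$ with $\omega_0=f\,e_{2h+1}$ in $\overline H$, and it has the form $$f=a\,\tilde f^{-1}\qquad\text{with } a\in\overline W,\ \tilde f\in A,\ \tilde f(0)=1.$$ -/

import Mathlib

open scoped TensorProduct Matrix

noncomputable section

namespace OrdCrystal

/-! ### Rings, Frobenius lifts -/

/-- `A = W(k)[[t₁, …, tₙ]]`. -/
abbrev PS (p : ℕ) [Fact p.Prime] (k : Type*) [Field k] (n : ℕ) : Type _ :=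
  MvPowerSeries (Fin n) (WittVector p k)

/-- A lift of Frobenius on `A = W(k)[[t]]`: a ring endomorphism that restricts to the Witt vector
Frobenius on `W(k)` and reduces modulo `p` to the `p`-th power map of `A / p = k[[t]]`. -/
structure FrobLift (p : ℕ) [Fact p.Prime] (k : Type*) [Field k] (n : ℕ) where
  toHom : PS p k n →+* PS p k n
  map_C : ∀ w : WittVector p k,
    toHom (MvPowerSeries.C w) = MvPowerSeries.C (WittVector.frobenius w)
  mod_p : ∀ a : PS p k n, (p : PS p k n) ∣ toHom a - a ^ p

/-- The ring endomorphism `∑ aₘ tᵐ ↦ ∑ σ(aₘ) t^(p m)` of `R[[t₁, …, tₙ]]`. -/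
def expandHom (p : ℕ) [hp : Fact p.Prime] {R : Type*} [CommRing R] (n : ℕ) (σ : R →+* R) :
    MvPowerSeries (Fin n) R →+* MvPowerSeries (Fin n) R :=
  (MvPowerSeries.expand p hp.out.ne_zero).toRingHom.comp (MvPowerSeries.map σ)

theorem dvd_of_coeff_dvd {R : Type*} [CommRing R] {n : ℕ} (q : ℕ) (f : MvPowerSeries (Fin n) R)
    (hf : ∀ m, (q : R) ∣ MvPowerSeries.coeff m f) : (q : MvPowerSeries (Fin n) R) ∣ f := by
  choose g hg using hf
  let G : MvPowerSeries (Fin n) R := fun m => g m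
  have hG : ∀ m, MvPowerSeries.coeff m G = g m := fun _ => rfl
  refine ⟨G, ?_⟩
  ext m
  have : (q : MvPowerSeries (Fin n) R) = MvPowerSeries.C (q : R) := by simp
  rw [this, MvPowerSeries.coeff_C_mul, hG, hg m]

/-- The standard lift of Frobenius: `φ(tᵢ) = tᵢᵖ`. -/
def stdLift (p : ℕ) [hp : Fact p.Prime] (k : Type*) [Field k] [CharP k p] [PerfectRing k p]
    (n : ℕ) : FrobLift p k n where
  toHom := expandHom p n WittVector.frobenius
  map_C w := by
    simp [expandHom, MvPowerSeries.expand_C]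
  mod_p a := by
    apply dvd_of_coeff_dvd
    intro m
    rw [← Ideal.mem_span_singleton, ← WittVector.ker_constantCoeff, RingHom.mem_ker,
      ← MvPowerSeries.coeff_map, map_sub, map_pow]
    have h1 : (WittVector.constantCoeff (p := p) (R := k)).comp WittVector.frobenius
        = (_root_.frobenius k p).comp WittVector.constantCoeff := by
      ext x
      simp [WittVector.constantCoeff, WittVector.coeff_frobenius_charP, frobenius_def]
    have h2 : MvPowerSeries.map (WittVector.constantCoeff (p := p) (R := k))
        (expandHom p n WittVector.frobenius a)
        = (MvPowerSeries.map WittVector.constantCoeff a) ^ p := by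
      rw [← MvPowerSeries.map_frobenius_expand p hp.out.ne_zero]
      simp only [expandHom, RingHom.comp_apply, AlgHom.toRingHom_eq_coe, RingHom.coe_coe,
        MvPowerSeries.map_expand, MvPowerSeries.map_map, h1]
    rw [h2, sub_self, map_zero]

/-- The map `W(k) → W(k')` attached to a field extension `k → k'`; together with Mathlib's
instance for power series rings it makes `W(k')[[t]]` an algebra over `W(k)[[t]]`. -/
instance (priority := 50) wittAlgebra (p : ℕ) [Fact p.Prime] (k kb : Type*) [Field k] [Field kb]
    [Algebra k kb] : Algebra (WittVector p k) (WittVector p kb) :=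
  (WittVector.map (algebraMap k kb)).toAlgebra

/-- `f` sums to `y` unconditionally in the `p`-adic topology. -/
def PadicHasSum (p : ℕ) {ι M : Type*} [AddCommGroup M] (f : ι → M) (y : M) : Prop :=
  ∀ N : ℕ, ∃ S₀ : Finset ι, ∀ S : Finset ι, S₀ ⊆ S → ∃ z : M, y - ∑ i ∈ S, f i = (p ^ N) • z

/-- A filtration indexed by `ℕ`, shifted by one step, with `⊥` in front. -/
def prevFil {α : Type*} [Bot α] (U : ℕ → α) : ℕ → α
  | 0 => ⊥
  | i + 1 => U i

/-! ### `F`-crystals -/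

/-- An `F`-crystal over `A₀ = k[[t₁, …, tₙ]]` with underlying `A`-module `H`.

Here `Ω¹_{A/W}` is the module of continuous differentials, which is free on `dt₁, …, dtₙ`, so that
the connection is `∇ x = ∑ j, dtⱼ ⊗ D j x`. An `A`-linear map `F(φ) : φ^* H → H` is the
same as a `φ`-semilinear map `H → H`, namely `F(φ)φ^*`; the latter is `F φ`. -/
structure FCrystal (p : ℕ) [Fact p.Prime] (k : Type*) [Field k] (n : ℕ)
    (H : Type*) [AddCommGroup H] [Module (PS p k n) H] where
  free : Module.Free (PS p k n) H
  finite : Module.Finite (PS p k n) H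
  /-- The covariant derivative in the direction `∂/∂tⱼ`. -/
  D : Fin n → AddMonoid.End H
  leibniz : ∀ (j : Fin n) (a : PS p k n) (x : H),
    D j (a • x) = MvPowerSeries.pderiv (WittVector p k) j a • x + a • D j x
  integrable : ∀ i j : Fin n, D i * D j = D j * D i
  nilpotent : ∀ (j : Fin n) (N : ℕ), ∃ M : ℕ, ∀ m ≥ M, ∀ x : H, ∃ z : H,
    (D j ^ m) x = (p ^ N) • z
  /-- The semilinear map `F(φ)φ^*`. -/
  F : ∀ φ : FrobLift p k n, H →ₛₗ[φ.toHom] H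
  /-- `∇ ∘ F(φ)φ^* = (φ ⊗ F(φ)φ^*) ∘ ∇`, where `φ(dtᵢ) = d(φ(tᵢ)) = ∑ j, ∂ⱼ(φ(tᵢ)) dtⱼ`. -/
  horizontal : ∀ (φ : FrobLift p k n) (j : Fin n) (x : H),
    D j (F φ x) = ∑ i : Fin n,
      MvPowerSeries.pderiv (WittVector p k) j (φ.toHom (MvPowerSeries.X i)) • F φ (D i x)
  /-- `F(φ) = F(ψ) ∘ χ(φ,ψ)`, evaluated on the generators `φ^*(x)` of `φ^* H`. The element
  `c j m` is `(p^m / m!) ((φ(tⱼ) - ψ(tⱼ)) / p)^m`, and is unique since `A` is torsion-free. -/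
  taylor : ∀ φ ψ : FrobLift p k n, ∃ c : Fin n → ℕ → PS p k n,
    (∀ j m, (m.factorial : PS p k n) * c j m
      = (φ.toHom (MvPowerSeries.X j) - ψ.toHom (MvPowerSeries.X j)) ^ m) ∧
    ∀ x : H, PadicHasSum p
      (fun m : Fin n → ℕ =>
        (∏ j, c j (m j)) • F ψ ((List.ofFn fun j => D j ^ m j).prod x))
      (F φ x)
  /-- `F(φ) ⊗ ℚ_p` is surjective; as `φ^* H` and `H` are free of the same finite rank, this says
  that it is an isomorphism. -/
  isogeny : ∀ φ : FrobLift p k n, ∃ N : ℕ, ∀ y : H,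
    (p ^ N) • y ∈ Submodule.span (PS p k n) (Set.range (F φ))

section ModP

variable (p : ℕ) [Fact p.Prime] (k : Type*) [Field k] (n : ℕ)
  (H : Type*) [AddCommGroup H] [Module (PS p k n) H]

/-- The ideal `pA`. -/
abbrev idealP : Ideal (PS p k n) := Ideal.span {(p : PS p k n)}

/-- `A₀ = A / pA = k[[t₁, …, tₙ]]`. -/
abbrev A0 : Type _ := PS p k n ⧸ idealP p k n

/-- `H₀ = H ⊗_A A₀ = H / pH`. -/
abbrev H0 : Type _ := H ⧸ (idealP p k n • ⊤ : Submodule (PS p k n) H)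

/-- Reduction modulo `p`, from `H` to `H₀`. -/
def modP : H →ₛₗ[Ideal.Quotient.mk (idealP p k n)] H0 p k n H where
  toFun := (idealP p k n • ⊤ : Submodule (PS p k n) H).mkQ
  map_add' := map_add _
  map_smul' _ _ := rfl

end ModP

section Fil

variable {p : ℕ} [Fact p.Prime] {k : Type*} [Field k] {n : ℕ}
  {H : Type*} [AddCommGroup H] [Module (PS p k n) H]

/-- A submodule `V` of `H` with `V ⊗_A A₀ = V₀` as submodules of `H₀`: the natural map from
`V / pV` to `H / pH` is injective with image `V₀`. -/
structure Lifts (V : Submodule (PS p k n) H) (V₀ : Submodule (A0 p k n) (H0 p k n H)) : Prop where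
  map_eq : V.map (modP p k n H) = V₀
  saturated : ∀ x : H, p • x ∈ V → x ∈ V

variable [CharP k p] [PerfectRing k p]

/-- The conjugate filtration `Fil_i H₀`: classes of those `y` with `pⁱ y ∈ Im F(φ)`. It does not
depend on the lift of Frobenius; we use the standard one. -/
def FCrystal.conjFil0 (C : FCrystal p k n H) (i : ℕ) : Submodule (A0 p k n) (H0 p k n H) :=
  ((Submodule.span (PS p k n) (Set.range (C.F (stdLift p k n)))).comap
    (LinearMap.lsmul (PS p k n) H ((p : PS p k n) ^ i))).map (modP p k n H)

/-- The Hodge filtration `Fil^i H₀`: classes of those `y` with `F(φ)φ^* y ∈ pⁱ H`. It does not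
depend on the lift of Frobenius; we use the standard one. -/
def FCrystal.hodgeFil0 (C : FCrystal p k n H) (i : ℕ) : Submodule (A0 p k n) (H0 p k n H) :=
  ((LinearMap.range (LinearMap.lsmul (PS p k n) H ((p : PS p k n) ^ i))).comap
    (C.F (stdLift p k n))).map (modP p k n H)

/-- `H` is of level `≤ N`. -/
def FCrystal.LevelLE (C : FCrystal p k n H) (N : ℕ) : Prop :=
  C.conjFil0 N = ⊤ ∧ C.hodgeFil0 (N + 1) = ⊥

/-- `H` is ordinary: the graded pieces of the conjugate filtration are free over `A₀`, and the
conjugate and Hodge filtrations of `H₀` are opposite. -/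
structure FCrystal.IsOrdinary (C : FCrystal p k n H) : Prop where
  free_gr : ∀ i : ℕ, Module.Free (A0 p k n)
    (C.conjFil0 i ⧸ (prevFil C.conjFil0 i).submoduleOf (C.conjFil0 i))
  opposite : ∀ i : ℕ, IsCompl (C.conjFil0 i) (C.hodgeFil0 (i + 1))

/-- The filtrations `0 = U₋₁ ⊆ U₀ ⊆ U₁ ⊆ …` of `H` by sub-`F`-crystals with
`U_i ⊗_A A₀ = Fil_i H₀` and `U_i / U_{i-1} ≃ V_i(-i)` for a unit `F`-crystal `V_i`. The last
condition says that `U_i / U_{i-1}` is free and that `F(φ)φ^*` on it is `pⁱ` times a semilinear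
map whose image generates. -/
structure FCrystal.IsUnitFiltration (C : FCrystal p k n H)
    (U : ℕ → Submodule (PS p k n) H) : Prop where
  mono : Monotone U
  D_mem : ∀ i j, ∀ x ∈ U i, C.D j x ∈ U i
  F_mem : ∀ i φ, ∀ x ∈ U i, C.F φ x ∈ U i
  lifts : ∀ i, Lifts (U i) (C.conjFil0 i)
  free_gr : ∀ i, Module.Free (PS p k n) (U i ⧸ (prevFil U i).submoduleOf (U i))
  twisted_unit : ∀ i φ,
    Submodule.span (PS p k n) (C.F φ '' U i) ⊔ prevFil U i
      = (U i).map (LinearMap.lsmul (PS p k n) H ((p : PS p k n) ^ i)) ⊔ prevFil U i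

/-- The step `U_i` of the unique filtration in `IsUnitFiltration` of an ordinary `F`-crystal. -/
def FCrystal.U (C : FCrystal p k n H) (i : ℕ) : Submodule (PS p k n) H :=
  sSup {V | ∃ U, C.IsUnitFiltration U ∧ V = U i}

end Fil

/-- A Hodge `F`-crystal: an `F`-crystal with a decreasing filtration by free submodules that lifts
the Hodge filtration of `H₀` and satisfies Griffiths transversality. -/
structure HodgeFCrystal (p : ℕ) [Fact p.Prime] (k : Type*) [Field k] [CharP k p] [PerfectRing k p]
    (n : ℕ) (H : Type*) [AddCommGroup H] [Module (PS p k n) H] extends FCrystal p k n H where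
  Fil : ℕ → Submodule (PS p k n) H
  Fil_zero : Fil 0 = ⊤
  Fil_anti : Antitone Fil
  Fil_free : ∀ i, Module.Free (PS p k n) (Fil i)
  Fil_lifts : ∀ i, Lifts (Fil i) (toFCrystal.hodgeFil0 i)
  transversal : ∀ i j, ∀ x ∈ Fil (i + 1), D j x ∈ Fil i

section Hodge

variable {p : ℕ} [Fact p.Prime] {k : Type*} [Field k] [CharP k p] [PerfectRing k p] {n : ℕ}
  {H : Type*} [AddCommGroup H] [Module (PS p k n) H]

/-- Divisibility of a Hodge `F`-crystal of level `≤ N`. -/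
def HodgeFCrystal.IsDivisible (C : HodgeFCrystal p k n H) (N : ℕ) : Prop :=
  ∃ φ : FrobLift p k n, ∀ i ≤ N, ∀ x ∈ C.Fil i, ∃ z : H, C.F φ x = (p ^ i) • z

/-- `H^i = U_i ∩ Fil^i H`. -/
def HodgeFCrystal.piece (C : HodgeFCrystal p k n H) (i : ℕ) : Submodule (PS p k n) H :=
  C.U i ⊓ C.Fil i

/-- The `A`-linear map `Fil³H → Fil²H / Fil³H` induced by `D j`. -/
def HodgeFCrystal.ksD (C : HodgeFCrystal p k n H) (j : Fin n) :
    C.Fil 3 →ₗ[PS p k n] (C.Fil 2 ⧸ (C.Fil 3).submoduleOf (C.Fil 2)) where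
  toFun x := Submodule.Quotient.mk ⟨C.D j x, C.transversal 2 j x x.2⟩
  map_add' x y := by
    rw [← Submodule.Quotient.mk_add]
    congr 1
    ext
    simp
  map_smul' a x := by
    rw [RingHom.id_apply, ← Submodule.Quotient.mk_smul, Submodule.Quotient.eq]
    change C.D j (a • (x : H)) - a • C.D j x ∈ C.Fil 3
    rw [C.leibniz, add_sub_cancel_right]
    exact (C.Fil 3).smul_mem _ x.2

/-- The map `T_{A/W} → Hom(H³, H²)` induced by the connection, for `H` of level `≤ 3`. Here `T_{A/W}`
is free on the `∂/∂tⱼ`, and `H³ = Fil³H`, `H² ≃ Fil²H / Fil³H`. -/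
def HodgeFCrystal.kodairaSpencer (C : HodgeFCrystal p k n H) :
    (Fin n → PS p k n) →ₗ[PS p k n]
      (C.Fil 3 →ₗ[PS p k n] (C.Fil 2 ⧸ (C.Fil 3).submoduleOf (C.Fil 2))) :=
  Fintype.linearCombination (PS p k n) C.ksD

end Hodge

/-- An ordinary CY3 crystal over `A₀ = k[[t₁, …, tₙ]]` with Hodge numbers `1, h, h, 1`. -/
structure CY3Crystal (p : ℕ) [Fact p.Prime] (k : Type*) [Field k] [CharP k p] [PerfectRing k p]
    (n h : ℕ) (H : Type*) [AddCommGroup H] [Module (PS p k n) H] extends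
    HodgeFCrystal p k n H where
  ordinary : toFCrystal.IsOrdinary
  level : toFCrystal.LevelLE 3
  divisible : toHodgeFCrystal.IsDivisible 3
  rank_zero : Module.finrank (PS p k n) (toHodgeFCrystal.piece 0) = 1
  rank_one : Module.finrank (PS p k n) (toHodgeFCrystal.piece 1) = h
  rank_two : Module.finrank (PS p k n) (toHodgeFCrystal.piece 2) = h
  rank_three : Module.finrank (PS p k n) (toHodgeFCrystal.piece 3) = 1
  /-- The bilinear form `⟨ , ⟩`. -/
  form : LinearMap.BilinForm (PS p k n) H
  form_alt : form.IsAlt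
  form_nondeg : Function.Bijective form
  form_D : ∀ j x y, form (D j x) y + form x (D j y)
    = MvPowerSeries.pderiv (WittVector p k) j (form x y)
  form_F : ∀ φ x y, form (F φ x) (F φ y) = (p : PS p k n) ^ 3 * φ.toHom (form x y)
  riemann_three : ∀ x, x ∈ Fil 1 ↔ ∀ y ∈ Fil 3, form y x = 0
  riemann_two : ∀ x, x ∈ Fil 2 ↔ ∀ y ∈ Fil 2, form y x = 0

/-! ### Base change to the algebraic closure -/

section BaseChange

variable {p : ℕ} [hp : Fact p.Prime] {k : Type*} [Field k] {n : ℕ}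
  {H : Type*} [AddCommGroup H] [Module (PS p k n) H] (kb : Type*) [Field kb] [Algebra k kb]

theorem pderiv_algebraMap (j : Fin n) (a : PS p k n) :
    MvPowerSeries.pderiv (WittVector p kb) j (algebraMap (PS p k n) (PS p kb n) a)
      = algebraMap (PS p k n) (PS p kb n) (MvPowerSeries.pderiv (WittVector p k) j a) := by
  ext1 m
  simp [MvPowerSeries.algebraMap_apply'', MvPowerSeries.coeff_pderiv]

theorem expandHom_algebraMap [CharP k p] (a : PS p k n) :
    expandHom p n WittVector.frobenius (algebraMap (PS p k n) (PS p kb n) a)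
      = algebraMap (PS p k n) (PS p kb n) (expandHom p n WittVector.frobenius a) := by
  have h1 : (WittVector.frobenius (p := p) (R := kb)).comp
        (algebraMap (WittVector p k) (WittVector p kb))
      = (algebraMap (WittVector p k) (WittVector p kb)).comp WittVector.frobenius := by
    have : CharP kb p := charP_of_injective_algebraMap (algebraMap k kb).injective p
    ext x m
    change (WittVector.frobenius (WittVector.map (algebraMap k kb) x)).coeff m
      = (WittVector.map (algebraMap k kb) (WittVector.frobenius x)).coeff m
    simp [WittVector.coeff_frobenius_charP]
  simp only [expandHom, MvPowerSeries.algebraMap_apply'', RingHom.comp_apply,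
    AlgHom.toRingHom_eq_coe, RingHom.coe_coe, MvPowerSeries.map_expand, MvPowerSeries.map_map, h1]

/-- The connection on `H̄ = Ā ⊗_A H`: `D̄ⱼ(b ⊗ x) = ∂ⱼ b ⊗ x + b ⊗ Dⱼ x`. -/
def FCrystal.Dbar (C : FCrystal p k n H) (j : Fin n) :
    PS p kb n ⊗[PS p k n] H →+ PS p kb n ⊗[PS p k n] H :=
  TensorProduct.liftAddHom
    (AddMonoidHom.mk' (fun b => AddMonoidHom.mk'
        (fun x => MvPowerSeries.pderiv (WittVector p kb) j b ⊗ₜ[PS p k n] x + b ⊗ₜ C.D j x)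
        (fun x y => by simp only [map_add, TensorProduct.tmul_add]; abel))
      (fun b c => by
        ext x
        simp only [map_add, TensorProduct.add_tmul, AddMonoidHom.mk'_apply,
          AddMonoidHom.add_apply]
        abel))
    (fun a b x => by
      have h1 : MvPowerSeries.pderiv (WittVector p kb) j (a • b)
          = a • MvPowerSeries.pderiv (WittVector p kb) j b
            + MvPowerSeries.pderiv (WittVector p k) j a • b := by
        rw [Algebra.smul_def, Derivation.leibniz, pderiv_algebraMap, smul_eq_mul, smul_eq_mul,
          Algebra.smul_def, Algebra.smul_def, mul_comm b]
      simp only [AddMonoidHom.mk'_apply, C.leibniz, TensorProduct.tmul_add, h1,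
        TensorProduct.add_tmul, TensorProduct.tmul_smul, TensorProduct.smul_tmul']
      abel)

variable [CharP k p] [PerfectRing k p]

/-- `F(φ)φ^*` on `H̄ = Ā ⊗_A H` for the standard lift of Frobenius `φ` of `Ā`, which preserves `A`:
`b ⊗ x ↦ φ(b) ⊗ F(φ)φ^* x`. -/
def FCrystal.Fbar (C : FCrystal p k n H) :
    PS p kb n ⊗[PS p k n] H →+ PS p kb n ⊗[PS p k n] H :=
  TensorProduct.liftAddHom
    (AddMonoidHom.mk' (fun b => AddMonoidHom.mk'
        (fun x => expandHom p n WittVector.frobenius b ⊗ₜ[PS p k n] C.F (stdLift p k n) x)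
        (fun x y => by simp only [map_add, TensorProduct.tmul_add]))
      (fun b c => by
        ext x
        simp only [map_add, TensorProduct.add_tmul, AddMonoidHom.mk'_apply,
          AddMonoidHom.add_apply]))
    (fun a b x => by
      simp only [AddMonoidHom.mk'_apply, Algebra.smul_def, map_mul, expandHom_algebraMap,
        LinearMap.map_smulₛₗ, TensorProduct.tmul_smul, TensorProduct.smul_tmul']
      rfl)

/-- `H̄^i = Ū_i ∩ Fil^i H̄`, with both filtrations obtained from those of `H` by base change. -/
def HodgeFCrystal.pieceBar (C : HodgeFCrystal p k n H) (i : ℕ) :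
    Submodule (PS p kb n) (PS p kb n ⊗[PS p k n] H) :=
  (C.U i).baseChange (PS p kb n) ⊓ (C.Fil i).baseChange (PS p kb n)

end BaseChange

/-! ### Adapted bases -/

/-- Index set of a basis `e₀; e₁, …, e_h; e_{h+1}, …, e_{2h}; e_{2h+1}`, in this order. -/
abbrev Idx (h : ℕ) : Type := (Unit ⊕ Fin h) ⊕ (Fin h ⊕ Unit)

/-- The Hodge degree of a basis vector. -/
def deg {h : ℕ} : Idx h → ℕ :=
  Sum.elim (Sum.elim (fun _ => 0) fun _ => 1) (Sum.elim (fun _ => 2) fun _ => 3)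

/-- The index `2h+1`. -/
def lastIdx (h : ℕ) : Idx h := Sum.inr (Sum.inr ())

/-- The normal form of the Gram matrix. -/
def gramMatrix (h : ℕ) (R : Type*) [CommRing R] : Matrix (Idx h) (Idx h) R :=
  Matrix.fromBlocks 0 (Matrix.fromBlocks 0 (-1) 1 0) (Matrix.fromBlocks 0 (-1) 1 0) 0

/-- The matrix `𝒯`, as a product of two unipotent matrices. -/
def tMatrix {h : ℕ} {R : Type*} [CommRing R] (τ₂₃ τ₁₃ : Matrix (Fin h) Unit R)
    (τ₁₂ : Matrix (Fin h) (Fin h) R) (Z : Matrix Unit Unit R) : Matrix (Idx h) (Idx h) R :=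
  Matrix.fromBlocks (Matrix.fromBlocks 1 τ₂₃ᵀ 0 1) 0 0 (Matrix.fromBlocks 1 τ₂₃ 0 1) *
    Matrix.fromBlocks 1 (Matrix.fromBlocks (-τ₁₃ᵀ) Z τ₁₂ τ₁₃) 0 1

section Adapted

variable {p : ℕ} [hp : Fact p.Prime] {k : Type*} [Field k] [CharP k p] [PerfectRing k p]
  {n h : ℕ} {H : Type*} [AddCommGroup H] [Module (PS p k n) H]
  {kb : Type*} [Field kb] [Algebra k kb]

/-- The matrix of an additive endomorphism with respect to a basis: its `j`-th column holds the
coordinates of the image of the `j`-th basis vector. -/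
def matrixOf {ι R M : Type*} [CommRing R] [AddCommGroup M] [Module R M]
    (e : Module.Basis ι R M) (g : M →+ M) : Matrix ι ι R :=
  Matrix.of fun i j => e.repr (g (e j)) i

/-- `Kᵘ[[t₁, …, tₙ]]`, where `Kᵘ = W̄[1/p]` is the fraction field of `W̄ = W(k̄)`. -/
abbrev KPS (p : ℕ) [Fact p.Prime] (kb : Type*) [Field kb] (n : ℕ) : Type _ :=
  MvPowerSeries (Fin n) (FractionRing (WittVector p kb))

/-- The inclusion of `Ā` into `Kᵘ[[t]]`. -/
def toKPS (p : ℕ) [Fact p.Prime] (kb : Type*) [Field kb] (n : ℕ) : PS p kb n →+* KPS p kb n :=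
  MvPowerSeries.map (algebraMap (WittVector p kb) (FractionRing (WittVector p kb)))

variable [CharP kb p] [PerfectRing kb p]

/-- The bases `e₀, …, e_{2h+1}` of `H̄` provided by the structure theorem for ordinary CY3
crystals: `eᵢ` lies in the right piece of `H̄ = H̄⁰ ⊕ H̄¹ ⊕ H̄² ⊕ H̄³`, the Gram matrix is in normal
form, and there is a matrix `𝒯` over `Kᵘ[[t]]` of the stated shape such that the connection matrix is
`𝒯⁻¹ d𝒯` and the Frobenius matrix is `𝒯⁻¹ P φ(𝒯)`, where `P = diag(1, p, p², p³)`. The last condition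
is only demanded for the standard lift of Frobenius. -/
structure CY3Crystal.IsAdaptedBasis (C : CY3Crystal p k n h H)
    (e : Module.Basis (Idx h) (PS p kb n) (PS p kb n ⊗[PS p k n] H)) : Prop where
  mem_piece : ∀ i, e i ∈ C.pieceBar kb (deg i)
  gram : ∀ i j, C.form.baseChange (PS p kb n) (e i) (e j) = gramMatrix h (PS p kb n) i j
  exists_tMatrix : ∃ (τ₂₃ τ₁₃ : Matrix (Fin h) Unit (KPS p kb n))
    (τ₁₂ : Matrix (Fin h) (Fin h) (KPS p kb n)) (Z : Matrix Unit Unit (KPS p kb n)),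
    (∀ j : Fin n, (matrixOf e (C.Dbar kb j)).map (toKPS p kb n)
      = (tMatrix τ₂₃ τ₁₃ τ₁₂ Z)⁻¹ * (tMatrix τ₂₃ τ₁₃ τ₁₂ Z).map
          (MvPowerSeries.pderiv (FractionRing (WittVector p kb)) j)) ∧
    (matrixOf e (C.Fbar kb)).map (toKPS p kb n)
      = (tMatrix τ₂₃ τ₁₃ τ₁₂ Z)⁻¹ * Matrix.diagonal (fun i => (p : KPS p kb n) ^ deg i) *
          (tMatrix τ₂₃ τ₁₃ τ₁₂ Z).map
            (expandHom p n (WittVector.FractionRing.frobeniusRingHom p kb))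

end Adapted

end OrdCrystal

end

open OrdCrystal

open scoped TensorProduct Matrix

/-! Write $\omega_0=f\,e_{2h+1}$. The last row of $\mathcal T$ is that of the identity, so $\nabla
e_{2h+1}$ has no $e_{2h+1}$-component, and the $e_{2h+1}$-coordinate of $\nabla_j\omega_0$ is
exactly $\partial_jf$. By the Gram matrix this coordinate is $-\langle e_0,\cdot\rangle$, hence
$\partial_jf/f=\langle e_0,\nabla_j\omega_0\rangle/\langle e_0,\omega_0\rangle$.

The vector $e_0$ lives only over $\overline A$, but it lies in the base change of $U_0$, which has
rank one over $A$. In a ratio of two pairings it may therefore be replaced by some $u\in U_0$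
(`baseChange_form_mul_comm_of_finrank_eq_one`), so the logarithmic derivatives of $f$ are fractions
of elements of $A$.

It remains to descend (`exists_eq_C_mul_algebraMap`). The series $f/f(0)$ and its Galois conjugates
have constant term $1$ and the same logarithmic derivatives, so in characteristic zero they
coincide. Thus $f/f(0)$ is Galois invariant and has coefficients in $W(k)$, since $\bar k/k$ is
Galois for perfect $k$. -/

namespace OrdCrystal

/-! ### Pairings with a submodule of rank one, before and after base change. -/

section RankOne

variable {R M : Type*} [CommRing R] [AddCommGroup M] [Module R M]

/-- Linear functionals are proportional on a submodule of rank one. -/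
theorem mul_apply_comm_of_finrank_eq_one [IsDomain R] {V : Submodule R M} (hV : Module.finrank R V = 1)
    {u v : M} (hu : u ∈ V) (hv : v ∈ V) (l l' : M →ₗ[R] R) : l u * l' v = l' u * l v := by
  have hr : Module.rank R V = 1 := Module.rank_eq_one_iff_finrank_eq_one.2 hV
  have hdep : ¬ LinearIndependent R ![(⟨u, hu⟩ : V), ⟨v, hv⟩] := by
    intro hli
    have h2 := hli.cardinal_lift_le_rank
    rw [hr] at h2
    simp at h2
  rw [LinearIndependent.pair_iff] at hdep
  push Not at hdep
  obtain ⟨a, b, hab, hne⟩ := hdep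
  have hab' : a • u + b • v = 0 := congrArg Subtype.val hab
  have h1 : a * l u + b * l v = 0 := by simpa using congrArg l hab'
  have h2 : a * l' u + b * l' v = 0 := by simpa using congrArg l' hab'
  -- The relation makes `(l u, l' u)` and `(l v, l' v)` proportional; whichever of `a`, `b` is
  -- nonzero can be cancelled.
  by_cases ha : a = 0
  · refine mul_left_cancel₀ (hne ha) ?_
    linear_combination l u * h2 - l' u * h1
  · refine mul_left_cancel₀ ha ?_
    linear_combination l' v * h1 - l v * h2

variable {S : Type*} [CommRing S] [Algebra R S]

/-- The identity is linear in `w`, so it suffices to check it on the generators `1 ⊗ v` with `v ∈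
V`, where it is the proportionality of the functionals `B · x` and `B · y` on `V`. It lets $e_0$ be
traded for a vector defined over $A$. -/
theorem baseChange_form_mul_comm_of_finrank_eq_one [IsDomain R] (B : LinearMap.BilinForm R M)
    {V : Submodule R M} (hV : Module.finrank R V = 1) {u : M} (hu : u ∈ V) {w : S ⊗[R] M}
    (hw : w ∈ V.baseChange S) (x y : M) :
    algebraMap R S (B u x) * B.baseChange S w (1 ⊗ₜ y)
      = algebraMap R S (B u y) * B.baseChange S w (1 ⊗ₜ x) := by
  rw [← Submodule.span_eq V, Submodule.baseChange_span] at hw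
  induction hw using Submodule.span_induction with
  | mem w hw =>
    obtain ⟨v, hv, rfl⟩ := hw
    have := mul_apply_comm_of_finrank_eq_one hV hu hv (B.flip x) (B.flip y)
    change B u x * B v y = B u y * B v x at this
    simp [Algebra.smul_def, ← map_mul, this]
  | zero => simp
  | add w w' _ _ h h' => simp only [map_add, LinearMap.add_apply, mul_add, h, h']
  | smul s w _ h =>
    simp only [map_smul, LinearMap.smul_apply, smul_eq_mul]
    linear_combination s * h

/-- Supplies a vector over $A$ with a nonzero denominator: if pairing with `x` killed all of `V`
after base change, it would kill its `S`-span. -/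
theorem exists_form_ne_zero_of_baseChange_form_ne_zero (B : LinearMap.BilinForm R M)
    {V : Submodule R M} {w : S ⊗[R] M} (hw : w ∈ V.baseChange S) {x : M}
    (hx : B.baseChange S w (1 ⊗ₜ x) ≠ 0) : ∃ u ∈ V, algebraMap R S (B u x) ≠ 0 := by
  contrapose! hx
  rw [← Submodule.span_eq V, Submodule.baseChange_span] at hw
  induction hw using Submodule.span_induction with
  | mem w hw =>
    obtain ⟨v, hv, rfl⟩ := hw
    simp [Algebra.smul_def, hx v hv]
  | zero => simp
  | add w w' _ _ h h' => simp only [map_add, LinearMap.add_apply, h, h', add_zero]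
  | smul s w _ h => simp only [map_smul, LinearMap.smul_apply, h, smul_zero]

end RankOne

/-! ### Logarithmic derivatives and Galois descent of power series. -/

section Galois

variable {p : ℕ} [hp : Fact p.Prime] {k : Type*} [Field k] {n : ℕ} {kb : Type*} [Field kb]

/-- A nonzero integer is a power of $p$, nonzero in the domain of Witt vectors, times an integer
prime to $p$, nonzero already in the residue field. -/
theorem charZero_wittVector (p : ℕ) [hp : Fact p.Prime] (kb : Type*) [Field kb] [CharP kb p] :
    CharZero (WittVector p kb) := by
  refine charZero_of_inj_zero fun m hm => ?_
  by_contra hm0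
  obtain ⟨v, r, hr, rfl⟩ := Nat.exists_eq_pow_mul_and_not_dvd hm0 p hp.out.ne_one
  push_cast at hm
  rcases mul_eq_zero.1 hm with h | h
  · exact WittVector.p_nonzero p kb (eq_zero_of_pow_eq_zero h)
  · have h0 : ((r : ℕ) : kb) = 0 := by
      simpa using congrArg (WittVector.constantCoeff (p := p) (R := kb)) h
    exact hr ((CharP.cast_eq_zero_iff kb p r).1 h0)

theorem pderiv_map {R S : Type*} [CommRing R] [CommRing S] (g : R →+* S) (j : Fin n)
    (f : MvPowerSeries (Fin n) R) :
    MvPowerSeries.pderiv S j (MvPowerSeries.map g f)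
      = MvPowerSeries.map g (MvPowerSeries.pderiv R j f) := by
  ext m
  simp [MvPowerSeries.coeff_pderiv]

/-- Power series with constant term `1` and the same logarithmic derivatives agree. -/
theorem eq_of_mul_pderiv_eq {R : Type*} [CommRing R] [IsAddTorsionFree R]
    {f g : MvPowerSeries (Fin n) R} (hf : MvPowerSeries.constantCoeff f = 1)
    (hg : MvPowerSeries.constantCoeff g = 1)
    (h : ∀ j, g * MvPowerSeries.pderiv R j f = f * MvPowerSeries.pderiv R j g) : f = g := by
  obtain ⟨u, rfl⟩ : IsUnit g := MvPowerSeries.isUnit_iff_constantCoeff.2 (by simp [hg])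
  -- The quotient $f/g$ has vanishing partial derivatives and constant term $1$; without additive
  -- torsion this forces it to be $1$.
  suffices hq : f * (u⁻¹ : (MvPowerSeries (Fin n) R)ˣ) = 1 from Units.mul_inv_eq_one.1 hq
  refine MvPowerSeries.pderiv.ext (fun j => ?_) ?_
  · have hu : (u : MvPowerSeries (Fin n) R) * (u⁻¹ : (MvPowerSeries (Fin n) R)ˣ) = 1 :=
      u.mul_inv
    rw [Derivation.leibniz, MvPowerSeries.pderiv_inv, MvPowerSeries.pderiv_one, smul_eq_mul,
      smul_eq_mul]
    linear_combination ((u⁻¹ : (MvPowerSeries (Fin n) R)ˣ) : MvPowerSeries (Fin n) R) ^ 2 * h j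
      - ((u⁻¹ : (MvPowerSeries (Fin n) R)ˣ) : MvPowerSeries (Fin n) R)
        * MvPowerSeries.pderiv R j f * hu
  · have hu : MvPowerSeries.constantCoeff (u : MvPowerSeries (Fin n) R)
        * MvPowerSeries.constantCoeff ((u⁻¹ : (MvPowerSeries (Fin n) R)ˣ) :
          MvPowerSeries (Fin n) R) = 1 := by
      rw [← map_mul, u.mul_inv, map_one]
    rw [hg, one_mul] at hu
    rw [map_mul, hf, hu, map_one, one_mul]

variable [Algebra k kb]

/-- The action of `Gal(k̄ / k)` on `W(k̄)[[t₁, …, tₙ]]`. -/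
noncomputable def galAct (p : ℕ) [Fact p.Prime] (n : ℕ) (s : kb ≃ₐ[k] kb) : PS p kb n →+* PS p kb n :=
  MvPowerSeries.map (WittVector.map (s : kb →+* kb))

theorem galAct_algebraMap (s : kb ≃ₐ[k] kb) (a : PS p k n) :
    galAct p n s (algebraMap (PS p k n) (PS p kb n) a) = algebraMap (PS p k n) (PS p kb n) a := by
  ext1 m
  rw [galAct, MvPowerSeries.coeff_map, MvPowerSeries.algebraMap_apply'', MvPowerSeries.coeff_map]
  ext i
  change s (algebraMap k kb _) = algebraMap k kb _
  exact s.commutes _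

/-- Galois descent for power series over Witt vectors. -/
theorem mem_range_algebraMap_of_galAct_eq [IsGalois k kb] {f : PS p kb n}
    (hf : ∀ s : kb ≃ₐ[k] kb, galAct p n s f = f) :
    f ∈ Set.range (algebraMap (PS p k n) (PS p kb n)) := by
  -- The Galois group acts separately on each Witt component of each coefficient, so descent reduces
  -- to the fixed field of $\bar k/k$.
  have hc : ∀ m i, ∃ c : k, algebraMap k kb c = (MvPowerSeries.coeff m f).coeff i := by
    intro m i
    refine (InfiniteGalois.mem_range_algebraMap_iff_fixed _).2 fun s => ?_
    have h1 := congrArg (fun g => (MvPowerSeries.coeff m g).coeff i) (hf s)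
    simpa [galAct, WittVector.map_coeff] using h1
  choose c hc using hc
  refine ⟨fun m => WittVector.mk p (c m), ?_⟩
  ext1 m
  ext i
  exact hc m i

theorem isGalois_of_isAlgClosure [CharP k p] [PerfectRing k p] [IsAlgClosure k kb] :
    IsGalois k kb := by
  have : PerfectField k := PerfectRing.toPerfectField k p
  have : Algebra.IsAlgebraic k kb := IsAlgClosure.isAlgebraic
  exact {}

/-- A unit of `W(k̄)[[t]]` whose logarithmic derivatives are quotients of elements of `W(k)[[t]]` is,
up to a constant factor, in `W(k)[[t]]`. -/
theorem exists_eq_C_mul_algebraMap [CharP kb p] [IsGalois k kb] (f : (PS p kb n)ˣ)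
    (hf : ∀ j, ∃ s r : PS p k n, algebraMap (PS p k n) (PS p kb n) s ≠ 0 ∧
      algebraMap (PS p k n) (PS p kb n) s
          * MvPowerSeries.pderiv (WittVector p kb) j (f : PS p kb n)
        = algebraMap (PS p k n) (PS p kb n) r * f) :
    ∃ (a : WittVector p kb) (g : PS p k n), MvPowerSeries.constantCoeff g = 1 ∧
      (f : PS p kb n) = MvPowerSeries.C a * algebraMap (PS p k n) (PS p kb n) g := by
  have hcz : CharZero (WittVector p kb) := charZero_wittVector p kb
  have hdom : IsDomain (PS p kb n) := NoZeroDivisors.to_isDomain _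
  obtain ⟨a, ha⟩ := MvPowerSeries.isUnit_constantCoeff _ f.isUnit
  have hinv : (MvPowerSeries.C (a : WittVector p kb) : PS p kb n)
      * MvPowerSeries.C ((a⁻¹ : (WittVector p kb)ˣ) : WittVector p kb) = 1 := by
    rw [← map_mul, a.mul_inv, map_one]
  -- Normalize to $g=f/f(0)$: constants do not change logarithmic derivatives.
  obtain ⟨g, hg⟩ : ∃ g : PS p kb n,
      g = MvPowerSeries.C ((a⁻¹ : (WittVector p kb)ˣ) : WittVector p kb) * (f : PS p kb n) := ⟨_, rfl⟩
  have hfg : (f : PS p kb n) = MvPowerSeries.C (a : WittVector p kb) * g := by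
    rw [hg, ← mul_assoc, hinv, one_mul]
  have hg1 : MvPowerSeries.constantCoeff g = 1 := by
    rw [hg, map_mul, MvPowerSeries.constantCoeff_C, ← ha, a.inv_mul]
  have hgD : ∀ j, ∃ s r : PS p k n, algebraMap (PS p k n) (PS p kb n) s ≠ 0 ∧
      algebraMap (PS p k n) (PS p kb n) s * MvPowerSeries.pderiv (WittVector p kb) j g
        = algebraMap (PS p k n) (PS p kb n) r * g := by
    intro j
    obtain ⟨s, r, hs, hsr⟩ := hf j
    refine ⟨s, r, hs, ?_⟩
    rw [hg, Derivation.leibniz, MvPowerSeries.pderiv_C, smul_zero, add_zero, smul_eq_mul]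
    linear_combination
      (MvPowerSeries.C ((a⁻¹ : (WittVector p kb)ˣ) : WittVector p kb) : PS p kb n) * hsr
  obtain ⟨g₀, hg₀⟩ := mem_range_algebraMap_of_galAct_eq (k := k) (f := g) fun s => by
    refine eq_of_mul_pderiv_eq ?_ hg1 fun j => ?_
    · rw [galAct, MvPowerSeries.constantCoeff_map, hg1, map_one]
    · obtain ⟨b, r, hb, hbr⟩ := hgD j
      -- The coefficients `b`, `r` come from $A$, so the conjugate of $g$ satisfies the same
      -- equation.
      have hbr' := congrArg (galAct p n s) hbr
      rw [map_mul, map_mul, galAct_algebraMap, galAct_algebraMap, galAct, ← pderiv_map,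
        ← galAct] at hbr'
      refine mul_left_cancel₀ hb ?_
      linear_combination g * hbr' - galAct p n s g * hbr
  refine ⟨a, g₀, ?_, by rw [hg₀, hfg]⟩
  apply WittVector.map_injective _ (algebraMap k kb).injective
  rw [map_one, ← hg1, ← hg₀, MvPowerSeries.algebraMap_apply'', MvPowerSeries.constantCoeff_map]
  rfl

end Galois

/-! ### The last coordinate: connection matrix and Gram matrix. -/

section Connection

theorem tMatrix_lastIdx {h : ℕ} {R : Type*} [CommRing R] (τ₂₃ τ₁₃ : Matrix (Fin h) Unit R)
    (τ₁₂ : Matrix (Fin h) (Fin h) R) (Z : Matrix Unit Unit R) (i : Idx h) :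
    tMatrix τ₂₃ τ₁₃ τ₁₂ Z (lastIdx h) i = (1 : Matrix (Idx h) (Idx h) R) (lastIdx h) i := by
  rw [tMatrix, Matrix.fromBlocks_multiply]
  rcases i with i | i | i
  · simp [lastIdx, Matrix.one_apply]
  · simp [lastIdx, Matrix.one_apply]
  · simp [lastIdx, Matrix.one_apply]

theorem isUnit_det_tMatrix {h : ℕ} {R : Type*} [CommRing R] (τ₂₃ τ₁₃ : Matrix (Fin h) Unit R)
    (τ₁₂ : Matrix (Fin h) (Fin h) R) (Z : Matrix Unit Unit R) :
    IsUnit (tMatrix τ₂₃ τ₁₃ τ₁₂ Z).det := by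
  simp [tMatrix, Matrix.det_mul, Matrix.det_fromBlocks_zero₂₁]

/-- If the last row of `T` is that of the identity, then so is that of `T⁻¹`. -/
theorem inv_row_eq_one {ι R : Type*} [Fintype ι] [DecidableEq ι] [CommRing R] {T : Matrix ι ι R}
    (hT : IsUnit T.det) {l : ι} (hl : ∀ i, T l i = (1 : Matrix ι ι R) l i) (i : ι) :
    T⁻¹ l i = (1 : Matrix ι ι R) l i := by
  rw [← Matrix.mul_nonsing_inv T hT, Matrix.mul_apply]
  simp [hl, Matrix.one_apply]

/-- The last row of $\mathcal T^{-1}$ is that of the identity, so this entry is the derivative of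
the corner entry $1$ of $\mathcal T$. -/
theorem inv_mul_map_pderiv_tMatrix_lastIdx {h n : ℕ} {R : Type*} [CommRing R]
    (τ₂₃ τ₁₃ : Matrix (Fin h) Unit (MvPowerSeries (Fin n) R))
    (τ₁₂ : Matrix (Fin h) (Fin h) (MvPowerSeries (Fin n) R))
    (Z : Matrix Unit Unit (MvPowerSeries (Fin n) R)) (j : Fin n) :
    ((tMatrix τ₂₃ τ₁₃ τ₁₂ Z)⁻¹ * (tMatrix τ₂₃ τ₁₃ τ₁₂ Z).map (MvPowerSeries.pderiv R j))
      (lastIdx h) (lastIdx h) = 0 := by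
  rw [Matrix.mul_apply]
  simp only [inv_row_eq_one (isUnit_det_tMatrix τ₂₃ τ₁₃ τ₁₂ Z) (tMatrix_lastIdx τ₂₃ τ₁₃ τ₁₂ Z),
    Matrix.one_apply, ite_mul, one_mul, zero_mul, Finset.sum_ite_eq, Finset.mem_univ, if_true,
    Matrix.map_apply, tMatrix_lastIdx]
  exact MvPowerSeries.pderiv_one

theorem toKPS_injective (p : ℕ) [Fact p.Prime] (kb : Type*) [Field kb] [CharP kb p] (n : ℕ) :
    Function.Injective (toKPS p kb n) := by
  intro f g hfg
  ext1 m
  apply IsFractionRing.injective (WittVector p kb) (FractionRing (WittVector p kb))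
  simpa [toKPS] using congrArg (MvPowerSeries.coeff m) hfg

variable {p : ℕ} [hp : Fact p.Prime] {k : Type*} [Field k] {n : ℕ}
  {H : Type*} [AddCommGroup H] [Module (PS p k n) H] {kb : Type*} [Field kb] [Algebra k kb]

theorem FCrystal.Dbar_tmul (C : FCrystal p k n H) (j : Fin n) (b : PS p kb n) (x : H) :
    C.Dbar kb j (b ⊗ₜ x)
      = MvPowerSeries.pderiv (WittVector p kb) j b ⊗ₜ[PS p k n] x + b ⊗ₜ C.D j x :=
  rfl

theorem FCrystal.Dbar_smul (C : FCrystal p k n H) (j : Fin n) (b : PS p kb n)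
    (x : PS p kb n ⊗[PS p k n] H) :
    C.Dbar kb j (b • x)
      = MvPowerSeries.pderiv (WittVector p kb) j b • x + b • C.Dbar kb j x := by
  induction x using TensorProduct.induction_on with
  | zero => simp
  | add x y hx hy => simp only [smul_add, map_add, hx, hy]; abel
  | tmul c x =>
    simp only [TensorProduct.smul_tmul', smul_eq_mul, FCrystal.Dbar_tmul, Derivation.leibniz,
      smul_add, TensorProduct.add_tmul]
    rw [mul_comm c]
    abel

variable [CharP k p] [PerfectRing k p] [CharP kb p] [PerfectRing kb p] {h : ℕ}
  {C : CY3Crystal p k n h H}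
  {e : Module.Basis (Idx h) (PS p kb n) (PS p kb n ⊗[PS p k n] H)}

theorem CY3Crystal.IsAdaptedBasis.repr_Dbar_lastIdx (he : C.IsAdaptedBasis e) (j : Fin n) :
    e.repr (C.Dbar kb j (e (lastIdx h))) (lastIdx h) = 0 := by
  obtain ⟨τ₂₃, τ₁₃, τ₁₂, Z, hD, -⟩ := he.exists_tMatrix
  apply toKPS_injective
  rw [map_zero, ← inv_mul_map_pderiv_tMatrix_lastIdx τ₂₃ τ₁₃ τ₁₂ Z j, ← hD j]
  rfl

/-- Among the basis vectors, $e_0$ pairs nontrivially only with $e_{2h+1}$, with value $-1$. This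
turns a coordinate into a pairing, which can be compared with pairings over $A$. -/
theorem CY3Crystal.IsAdaptedBasis.form_zero_apply (he : C.IsAdaptedBasis e)
    (z : PS p kb n ⊗[PS p k n] H) :
    C.form.baseChange (PS p kb n) (e (Sum.inl (Sum.inl ()))) z = -e.repr z (lastIdx h) := by
  conv_lhs => rw [← e.sum_repr z]
  simp only [map_sum, map_smul, he.gram, smul_eq_mul]
  simp [gramMatrix, lastIdx]

end Connection

end OrdCrystal

/-! ### The lemma on the generator of $\mathrm{Fil}^3H$. -/

open OrdCrystal
theorem lemma3p1 (p : ℕ) [Fact p.Prime] (hp : 3 < p)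
    (k : Type*) [Field k] [CharP k p] [PerfectRing k p]
    (kb : Type*) [Field kb] [CharP kb p] [PerfectRing kb p] [Algebra k kb] [IsAlgClosure k kb]
    (n h : ℕ) (H : Type*) [AddCommGroup H] [Module (PS p k n) H]
    (C : CY3Crystal p k n h H) (hKS : Function.Bijective C.kodairaSpencer)
    (e : Module.Basis (Idx h) (PS p kb n) (PS p kb n ⊗[PS p k n] H)) (he : C.IsAdaptedBasis e)
    (ω₀ : H) (hω₀ : Submodule.span (PS p k n) {ω₀} = C.Fil 3) :
    ∃ f : (PS p kb n)ˣ,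
      (1 : PS p kb n) ⊗ₜ[PS p k n] ω₀ = (f : PS p kb n) • e (lastIdx h) ∧
      ∃ (a : WittVector p kb) (f' : (PS p k n)ˣ),
        MvPowerSeries.constantCoeff (f' : PS p k n) = 1 ∧
        (f : PS p kb n) = MvPowerSeries.C a *
          algebraMap (PS p k n) (PS p kb n) ((f'⁻¹ : (PS p k n)ˣ) : PS p k n) := by
  have : IsGalois k kb := isGalois_of_isAlgClosure (p := p)
  have : IsDomain (PS p k n) := NoZeroDivisors.to_isDomain _
  obtain ⟨g, hg⟩ : ∃ g : PS p kb n, g • (1 : PS p kb n) ⊗ₜ[PS p k n] ω₀ = e (lastIdx h) := by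
    have h3 := (he.mem_piece (lastIdx h)).2
    change e (lastIdx h) ∈ (C.Fil 3).baseChange (PS p kb n) at h3
    rw [← hω₀, Submodule.baseChange_span, Set.image_singleton] at h3
    exact Submodule.mem_span_singleton.1 h3
  -- Being a member of a basis, $e_{2h+1}$ has last coordinate $1$; this makes `g` a unit whose
  -- inverse is the wanted $f$.
  have hgf : g * e.repr ((1 : PS p kb n) ⊗ₜ[PS p k n] ω₀) (lastIdx h) = 1 := by
    simpa using congrArg (fun z => e.repr z (lastIdx h)) hg
  obtain ⟨f, hf⟩ : ∃ f : (PS p kb n)ˣ,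
      (f : PS p kb n) = e.repr ((1 : PS p kb n) ⊗ₜ[PS p k n] ω₀) (lastIdx h) :=
    ⟨⟨_, g, (mul_comm _ _).trans hgf, hgf⟩, rfl⟩
  have hωf : (1 : PS p kb n) ⊗ₜ[PS p k n] ω₀ = (f : PS p kb n) • e (lastIdx h) := by
    rw [← hg, smul_smul, hf, mul_comm, hgf, one_smul]
  -- Leibniz on $f\,e_{2h+1}$: the term $f\,\nabla_je_{2h+1}$ has zero last coordinate.
  have hDf : ∀ j, e.repr ((1 : PS p kb n) ⊗ₜ[PS p k n] C.D j ω₀) (lastIdx h)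
      = MvPowerSeries.pderiv (WittVector p kb) j (f : PS p kb n) := by
    intro j
    have h1 := C.Dbar_tmul (kb := kb) j 1 ω₀
    rw [MvPowerSeries.pderiv_one, TensorProduct.zero_tmul, zero_add] at h1
    rw [← h1, hωf, FCrystal.Dbar_smul]
    simp [he.repr_Dbar_lastIdx j]
  have he0 : e (Sum.inl (Sum.inl ())) ∈ (C.U 0).baseChange (PS p kb n) :=
    (he.mem_piece (Sum.inl (Sum.inl ()))).1
  have hrank : Module.finrank (PS p k n) (C.U 0) = 1 := by
    have h1 := C.rank_zero
    rwa [HodgeFCrystal.piece, C.Fil_zero, inf_top_eq] at h1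
  -- Here $\langle e_0,\omega_0\rangle=-f\neq0$.
  obtain ⟨u, hu, hu0⟩ := exists_form_ne_zero_of_baseChange_form_ne_zero C.form he0 (x := ω₀) (by
    rw [he.form_zero_apply, ← hf]
    exact neg_ne_zero.2 f.ne_zero)
  obtain ⟨a, f₀, hf₀, hff₀⟩ := exists_eq_C_mul_algebraMap (k := k) f fun j =>
    ⟨C.form u ω₀, C.form u (C.D j ω₀), hu0, by
      have h1 := baseChange_form_mul_comm_of_finrank_eq_one C.form hrank hu he0 ω₀ (C.D j ω₀)
      rw [he.form_zero_apply, he.form_zero_apply, hDf, ← hf] at h1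
      linear_combination -h1⟩
  -- The descended series is $\tilde f^{-1}$, so $\tilde f$ is its inverse.
  obtain ⟨v, rfl⟩ : IsUnit f₀ := MvPowerSeries.isUnit_iff_constantCoeff.2 (by simp [hf₀])
  refine ⟨f, hωf, a, v⁻¹, ?_, by rw [inv_inv, hff₀]⟩
  have hv : MvPowerSeries.constantCoeff (v : PS p k n)
      * MvPowerSeries.constantCoeff ((v⁻¹ : (PS p k n)ˣ) : PS p k n) = 1 := by
    rw [← map_mul, v.mul_inv, map_one]
  rwa [hf₀, one_mul] at hv
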